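/- Let $\mathbb{K}$ be $\mathbb{Z}$ with the digital (Khalimsky) topology, generated by the sets $\{n\}$ for $n$ odd and $\{n-1,n,n+1\}$ for $n$ even, and let $\mathbb{K}^2$ carry the product topology. A point of $\mathbb{K}^2$ is pure if its two coordinates have the same parity, and mixed otherwise. For $x\in\mathbb{K}^2$ let $N(x)$ be the smallest open set containing $x$, let $cl(x)$ be the closure of $\{x\}$, and let $A(x)=\{y\neq x:\{x,y\}\text{ is connected}\}$. An arc is a subset that is homeomorphic, in the subspace topology, to a nonempty finite interval $\{a,a+1,\dots,b\}$ of $\mathbb{K}$. A Jordan curve is a connected set $J\subseteq\mathbb{K}^2$ with at least four points such that $J\setminus\{x\}$ is an arc for every $x\in J$. Let $\Gamma:\mathbb{Z}^2\to\mathbb{K}^2$, $\Gamma(x,y)=(x+y,y-x)$, and for $B\subseteq\mathbb{Z}^2$ let $$\Gamma^*(B)=\Gamma(B)\cup\{x\in\mathbb{K}^2: x\text{ is mixed, and } N(x)\subseteq\Gamma(B)\cup\{x\}\text{ or }cl(x)\subseteq\Gamma(B)\cup\{x\}\}.$$ For $J\subseteq\mathbb{K}^2$ let $S_J=\{x\in\Gamma^*(\Gamma^{-1}(J)):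 x\text{ is mixed and }|A(x)\cap J|=3\}$. **Theorem.** Let $J$ be a Jordan curve in $\mathbb{K}^2$ and let $m\in\mathbb{K}^2$ be such that $S_J=\{m\}$ and $\Gamma^*(\Gamma^{-1}(J))=J\cup\{m\}$. Then $\mathbb{K}^2\setminus J$ has exactly two connected components. -/

import Mathlib

namespace DigitalTopology

/-- The underlying set of the digital line `𝕂`: the integers. -/
def DigitalLine : Type := ℤ

/-- The integer underlying a point of the digital line. -/
def DigitalLine.toInt (x : DigitalLine) : ℤ := x

/-- An integer, regarded as a point of the digital line. -/
def DigitalLine.ofInt (n : ℤ) : DigitalLine := n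

/-- The generating sets of the digital topology: `{n}` for `n` odd, `{n - 1, n, n + 1}` for
`n` even. -/
def DigitalLine.basicNhd (n : ℤ) : Set DigitalLine :=
  {x | if Odd n then x.toInt = n else (x.toInt = n - 1 ∨ x.toInt = n ∨ x.toInt = n + 1)}

/-- The digital (Khalimsky) topology. -/
instance : TopologicalSpace DigitalLine :=
  TopologicalSpace.generateFrom (Set.range DigitalLine.basicNhd)

/-- The digital plane `𝕂²`, with the product topology. -/
abbrev DigitalPlane : Type := DigitalLine × DigitalLine

/-- A point of the digital plane is pure if its coordinates are both even or both odd. -/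
def IsPure (x : DigitalPlane) : Prop :=
  (Even x.1.toInt ∧ Even x.2.toInt) ∨ (Odd x.1.toInt ∧ Odd x.2.toInt)

/-- A point of the digital plane is mixed if it is not pure. -/
def IsMixed (x : DigitalPlane) : Prop := ¬ IsPure x

/-- The adjacency `A(x)` of a point. -/
def adjacency {X : Type*} [TopologicalSpace X] (x : X) : Set X :=
  {y | y ≠ x ∧ IsConnected ({x, y} : Set X)}

/-- The (nonempty) finite interval `{a, a + 1, …, b}` of the digital line. -/
def DigitalLine.interval (a b : ℤ) : Set DigitalLine := {x | a ≤ x.toInt ∧ x.toInt ≤ b}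

/-- An arc: a subset which, with the subspace topology, is homeomorphic to a finite interval of
the digital line. -/
def IsArc {X : Type*} [TopologicalSpace X] (C : Set X) : Prop :=
  ∃ a b : ℤ, a ≤ b ∧ Nonempty (DigitalLine.interval a b ≃ₜ C)

/-- A Jordan curve: a connected subset with at least four points that becomes an arc when any
one of its points is removed. -/
def IsJordanCurve {X : Type*} [TopologicalSpace X] (J : Set X) : Prop :=
  IsConnected J ∧ 4 ≤ J.encard ∧ ∀ x ∈ J, IsArc (J \ {x})

/-- The slant map `Γ : ℤ² → 𝕂²`, `Γ(x, y) = (x + y, y - x)`. -/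
def slant (p : ℤ × ℤ) : DigitalPlane :=
  (DigitalLine.ofInt (p.1 + p.2), DigitalLine.ofInt (p.2 - p.1))

/-- The operator `Γ*`. Here `nhdsKer {x}` is the minimal open neighbourhood `N(x)` of `x` and
`closure {x}` is `cl(x)`. -/
def slantStar (A : Set (ℤ × ℤ)) : Set DigitalPlane :=
  slant '' A ∪ {x | IsMixed x ∧
    (nhdsKer {x} ⊆ slant '' A ∪ {x} ∨ closure {x} ⊆ slant '' A ∪ {x})}

/-- The set `S_J` of mixed points of `Γ*(Γ⁻¹(J))` that are adjacent to exactly three points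
of `J`. -/
def threeAdjacent (J : Set DigitalPlane) : Set DigitalPlane :=
  {m | m ∈ slantStar (slant ⁻¹' J) ∧ IsMixed m ∧ (adjacency m ∩ J).encard = 3}

end DigitalTopology

/-! ### The plane as a graph on the integer lattice. -/

namespace DigitalTopology

open Finset Relation

/-! This is a discrete Jordan curve theorem. Two distinct points are adjacent exactly when one
specializes to the other, so an arc is an induced path in the graph `KAdj`. As deleting any point of
`J` leaves a path, counting edges shows that every point of `J` has exactly two neighbours in `J`;
since `J` has at least four points, it also contains no triangle. At least two components: the
parity `crossing` of the edges of `J` met by a rightward ray is constant along adjacencies off `J`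
(`crossing_eq_of_kAdj`) and takes two values (`exists_crossing_ne`). At most two: the neighbours of
a point `v` of `J` form a cycle, which `J` cuts at two points into two sides. Each side contains a
common neighbour of `v` and the next point of `J`, so the same two classes persist all along `J`
(`exists_joined_or_joined`). -/

/-- Adjacency of distinct points of the digital plane in integer coordinates: eight neighbours at
a pure point, four neighbours at a mixed one. -/
def KAdj (u v : ℤ × ℤ) : Prop :=
  ¬(u.1 = v.1 ∧ u.2 = v.2) ∧ u.1 ≤ v.1 + 1 ∧ v.1 ≤ u.1 + 1 ∧ u.2 ≤ v.2 + 1 ∧ v.2 ≤ u.2 + 1 ∧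
    ((u.1 - u.2) % 2 = 0 ∨ u.1 = v.1 ∨ u.2 = v.2)

instance : DecidableRel KAdj := fun u v => by unfold KAdj; infer_instance

theorem KAdj.symm {u v : ℤ × ℤ} (h : KAdj u v) : KAdj v u := by
  unfold KAdj at *; omega

theorem KAdj.ne {u v : ℤ × ℤ} (h : KAdj u v) : u ≠ v := by
  rintro rfl; exact h.1 ⟨rfl, rfl⟩

theorem reflTransGen_kAdj (u v : ℤ × ℤ) : ReflTransGen KAdj u v := by
  have : Std.Symm KAdj := ⟨fun _ _ h => h.symm⟩
  have h0 : ∀ x y : ℤ, ReflTransGen KAdj (0, 0) (x, y) := by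
    intro x y
    have h1 : ReflTransGen KAdj (0, 0) (x, 0) := by
      induction x using Int.induction_on with
      | zero => exact .refl
      | succ i ih => exact ih.tail (by unfold KAdj; omega)
      | pred i ih => exact ih.tail (by unfold KAdj; omega)
    refine h1.trans ?_
    induction y using Int.induction_on with
    | zero => exact .refl
    | succ i ih => exact ih.tail (by unfold KAdj; omega)
    | pred i ih => exact ih.tail (by unfold KAdj; omega)
  exact (_root_.symm (h0 u.1 u.2)).trans (h0 v.1 v.2)

/-! ### Lower bound: parity of crossings. -/

/-- Parity of the number of edges of `J` from row `b` to row `b + 1` whose lower end lies to the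
right of column `a`. -/
def crossing (J : Finset (ℤ × ℤ)) (a b : ℤ) : ZMod 2 :=
  ∑ e ∈ J ×ˢ J, if KAdj e.1 e.2 ∧ e.1.2 = b ∧ e.2.2 = b + 1 ∧ a < e.1.1 then 1 else 0

section Crossing

variable {J : Finset (ℤ × ℤ)} (hdeg : ∀ u ∈ J, #{v ∈ J | KAdj u v} = 2)

include hdeg in
-- The degrees of the points of `J` in row `b` right of column `a` have even sum. Horizontal edges
-- count twice there, so upward and downward edges agree mod 2.
theorem crossing_eq_lower {a b : ℤ} (hab : (a, b) ∉ J) :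
    crossing J a b = ∑ e ∈ J ×ˢ J,
      if KAdj e.1 e.2 ∧ e.1.2 = b - 1 ∧ e.2.2 = b ∧ a < e.2.1 then 1 else 0 := by
  have hswap : (∑ e ∈ J ×ˢ J,
      if KAdj e.1 e.2 ∧ e.1.2 = b - 1 ∧ e.2.2 = b ∧ a < e.2.1 then (1 : ZMod 2) else 0) =
      ∑ e ∈ J ×ˢ J, if KAdj e.1 e.2 ∧ e.1.2 = b ∧ e.2.2 = b - 1 ∧ a < e.1.1 then 1 else 0 := by
    refine sum_bij (fun e _ => e.swap) ?_ ?_ ?_ ?_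
    · intro e he; simp only [mem_product, Prod.fst_swap, Prod.snd_swap] at he ⊢; exact he.symm
    · intro e _ f _ h; exact Prod.swap_injective h
    · intro e he
      refine ⟨e.swap, ?_, Prod.swap_swap e⟩
      simp only [mem_product, Prod.fst_swap, Prod.snd_swap] at he ⊢; exact he.symm
    · intro e _
      refine if_congr ?_ rfl rfl
      simp only [KAdj, Prod.fst_swap, Prod.snd_swap]
      omega
  have hhor : (∑ e ∈ J ×ˢ J,
      if KAdj e.1 e.2 ∧ e.1.2 = b ∧ e.2.2 = b ∧ a < e.1.1 ∧ a < e.2.1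
        then (1 : ZMod 2) else 0) = 0 := by
    refine sum_involution (fun e _ => e.swap) ?_ ?_ ?_ ?_
    · intro e _
      have : (KAdj e.swap.1 e.swap.2 ∧ e.swap.1.2 = b ∧ e.swap.2.2 = b ∧ a < e.swap.1.1 ∧
          a < e.swap.2.1) ↔
          (KAdj e.1 e.2 ∧ e.1.2 = b ∧ e.2.2 = b ∧ a < e.1.1 ∧ a < e.2.1) := by
        simp only [KAdj, Prod.fst_swap, Prod.snd_swap]; omega
      rw [if_congr this rfl rfl]
      exact CharTwo.add_self_eq_zero _
    · intro e _ he hs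
      have h1 : KAdj e.1 e.2 := by
        by_contra h; exact he (if_neg fun h' => h h'.1)
      exact h1.ne (congrArg Prod.snd hs)
    · intro e he; simp only [mem_product, Prod.fst_swap, Prod.snd_swap] at he ⊢; exact he.symm
    · intro e _; exact Prod.swap_swap e
  have htot : (∑ e ∈ J ×ˢ J,
      if KAdj e.1 e.2 ∧ e.1.2 = b ∧ a < e.1.1 then (1 : ZMod 2) else 0) = 0 := by
    rw [sum_product]
    refine sum_eq_zero fun u hu => ?_
    by_cases h : u.2 = b ∧ a < u.1
    · simp only [h, and_true]
      rw [sum_boole, hdeg u hu]; rfl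
    · exact sum_eq_zero fun v _ => if_neg fun h' => h h'.2
  have hsum : crossing J a b + (∑ e ∈ J ×ˢ J,
      if KAdj e.1 e.2 ∧ e.1.2 = b ∧ e.2.2 = b - 1 ∧ a < e.1.1 then (1 : ZMod 2) else 0) +
      (∑ e ∈ J ×ˢ J, if KAdj e.1 e.2 ∧ e.1.2 = b ∧ e.2.2 = b ∧ a < e.1.1 ∧ a < e.2.1
        then (1 : ZMod 2) else 0) =
      ∑ e ∈ J ×ˢ J, if KAdj e.1 e.2 ∧ e.1.2 = b ∧ a < e.1.1 then (1 : ZMod 2) else 0 := by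
    rw [crossing, ← sum_add_distrib, ← sum_add_distrib]
    refine sum_congr rfl fun e he => ?_
    -- As `(a, b)` is off `J`, a horizontal edge starting right of column `a` also ends right of it.
    have h2 : ¬(e.2.1 = a ∧ e.2.2 = b) := by
      rintro ⟨rfl, rfl⟩; exact hab (mem_product.1 he).2
    by_cases h : KAdj e.1 e.2 ∧ e.1.2 = b ∧ a < e.1.1
    · rw [if_pos h]
      unfold KAdj at h
      have hK : KAdj e.1 e.2 := by unfold KAdj; omega
      rcases (by omega : e.2.2 = b + 1 ∨ e.2.2 = b - 1 ∨ e.2.2 = b) with h3 | h3 | h3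
      · rw [if_pos ⟨hK, by omega⟩, if_neg (by omega), if_neg (by omega)]; rfl
      · rw [if_neg (by omega), if_pos ⟨hK, by omega⟩, if_neg (by omega)]; rfl
      · rw [if_neg (by omega), if_neg (by omega), if_pos ⟨hK, by omega⟩]; rfl
    · rw [if_neg h, if_neg (by tauto), if_neg (by tauto), if_neg (by tauto)]; rfl
  rw [hhor, htot, add_zero] at hsum
  rw [hswap]
  exact CharTwo.add_eq_zero.1 hsum

include hdeg in
-- An edge counted for only one of `x`, `y` would pass through one of them or cross the segment
-- between them. Two crossing diagonals are impossible: one would join mixed points.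
theorem crossing_eq_of_kAdj {x y : ℤ × ℤ} (hx : x ∉ J) (hy : y ∉ J) (h : KAdj x y) :
    crossing J x.1 x.2 = crossing J y.1 y.2 := by
  wlog hle : x.2 ≤ y.2 generalizing x y
  · exact (this hy hx h.symm (by omega)).symm
  have key : ∀ e ∈ J ×ˢ J, ¬(e.1.1 = x.1 ∧ e.1.2 = x.2) ∧ ¬(e.1.1 = y.1 ∧ e.1.2 = y.2) ∧
      ¬(e.2.1 = x.1 ∧ e.2.2 = x.2) ∧ ¬(e.2.1 = y.1 ∧ e.2.2 = y.2) := by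
    intro e he
    obtain ⟨h1, h2⟩ := mem_product.1 he
    refine ⟨?_, ?_, ?_, ?_⟩ <;> rintro ⟨ha, hb⟩
    · exact hx (Prod.ext ha hb ▸ h1)
    · exact hy (Prod.ext ha hb ▸ h1)
    · exact hx (Prod.ext ha hb ▸ h2)
    · exact hy (Prod.ext ha hb ▸ h2)
  rcases hle.eq_or_lt with heq | hlt
  · refine sum_congr rfl fun e he => if_congr ?_ rfl rfl
    have := key e he
    unfold KAdj at *
    omega
  · rw [crossing_eq_lower hdeg (a := y.1) (b := y.2) hy]
    refine sum_congr rfl fun e he => if_congr ?_ rfl rfl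
    have := key e he
    unfold KAdj at *
    omega

include hdeg in
theorem exists_crossing_ne (hne : J.Nonempty)
    (htri : ∀ u ∈ J, ∀ v ∈ J, ∀ w ∈ J, KAdj u v → KAdj v w → ¬KAdj u w) :
    ∃ x y, x ∉ J ∧ y ∉ J ∧ crossing J x.1 x.2 ≠ crossing J y.1 y.2 := by
  -- `s` is the rightmost point of the lowest row of `J`. The witnesses will be the point right of
  -- `s` and the point left of its neighbour `r`, separated by the edge from `s` to `r`.
  obtain ⟨c, hc, hcmin⟩ := J.exists_min_image (fun u => u.2) hne
  obtain ⟨s, hs, hsmax⟩ := {u ∈ J | u.2 = c.2}.exists_max_image (fun u => u.1)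
    ⟨c, mem_filter.2 ⟨hc, rfl⟩⟩
  obtain ⟨hsJ, hsc⟩ := mem_filter.1 hs
  have hlow : ∀ u ∈ J, s.2 ≤ u.2 ∧ (u.2 = s.2 → u.1 ≤ s.1) := fun u hu =>
    ⟨hsc ▸ hcmin u hu, fun h => hsmax u (mem_filter.2 ⟨hu, h.trans hsc⟩)⟩
  obtain ⟨p, q, hpq, hN⟩ := card_eq_two.1 (hdeg s hsJ)
  have hN' : ∀ v, v ∈ J ∧ KAdj s v ↔ v = p ∨ v = q := fun v => by
    rw [← mem_filter, hN, mem_insert, mem_singleton]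
  have hp := (hN' p).2 (Or.inl rfl)
  have hq := (hN' q).2 (Or.inr rfl)
  have hnadj : ¬KAdj p q := fun h => htri s hsJ p hp.1 q hq.1 hp.2 h hq.2
  -- the neighbour of `s` furthest to the right in the row above
  obtain ⟨r, hrJ, hr, hr2, hr1, hrmax⟩ : ∃ r ∈ J, KAdj s r ∧ r.2 = s.2 + 1 ∧ s.1 ≤ r.1 ∧
      ∀ v ∈ J, KAdj s v → v ≠ r → v.1 < r.1 - 1 ∨ v.2 = s.2 := by
    have h1 := hlow p hp.1
    have h2 := hlow q hq.1
    have hpq' : ¬(p.1 = q.1 ∧ p.2 = q.2) := fun h => hpq (Prod.ext h.1 h.2)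
    have h3 := hp.2
    have h4 := hq.2
    by_cases hc : p.2 = s.2 + 1 ∧ (q.2 = s.2 + 1 → q.1 < p.1)
    · refine ⟨p, hp.1, hp.2, hc.1, ?_, ?_⟩
      · unfold KAdj at *; omega
      · intro v hv hsv hvp
        rcases (hN' v).1 ⟨hv, hsv⟩ with rfl | rfl
        · exact absurd rfl hvp
        · unfold KAdj at *; omega
    · refine ⟨q, hq.1, hq.2, ?_, ?_, ?_⟩
      · unfold KAdj at *; omega
      · unfold KAdj at *; omega
      · intro v hv hsv hvp
        rcases (hN' v).1 ⟨hv, hsv⟩ with rfl | rfl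
        · unfold KAdj at *; omega
        · exact absurd rfl hvp
  -- A mixed `s` could only have its left and upper neighbours in `J`, and these are adjacent.
  have hpure : (s.1 - s.2) % 2 = 0 := by
    have h1 := hlow p hp.1
    have h2 := hlow q hq.1
    have hpq' : ¬(p.1 = q.1 ∧ p.2 = q.2) := fun h => hpq (Prod.ext h.1 h.2)
    have h3 := hp.2
    have h4 := hq.2
    unfold KAdj at *; omega
  have hz : (r.1 - 1, r.2) ∉ J := fun hzJ => by
    have h3 : KAdj s (r.1 - 1, r.2) := by unfold KAdj at *; dsimp only; omega
    have h4 := hrmax _ hzJ h3 fun h => by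
      have := congrArg Prod.fst h; dsimp only at this; omega
    dsimp only at h4
    omega
  refine ⟨(s.1 + 1, s.2), (r.1 - 1, r.2), fun h => ?_, hz, ?_⟩
  · have := (hlow _ h).2 rfl
    dsimp only at this; omega
  · have h0 : crossing J (s.1 + 1) s.2 = 0 := sum_eq_zero fun e he => if_neg fun h => by
      have := hlow _ (mem_product.1 he).1
      omega
    have h1 : crossing J (r.1 - 1) r.2 = 1 := by
      rw [crossing_eq_lower hdeg hz, sum_eq_single (s, r)]
      · exact if_pos ⟨hr, by dsimp only; omega⟩
      · rintro ⟨u, v⟩ he hne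
        obtain ⟨hu, hv⟩ := mem_product.1 he
        dsimp only at hu hv ⊢
        refine if_neg fun ⟨hK, hu2, hv2, hv1⟩ => ?_
        have h5 := hlow u hu
        by_cases hus : u = s
        · subst hus
          have := hrmax v hv hK fun h => hne (by rw [h])
          omega
        · have : ¬(u.1 = s.1 ∧ u.2 = s.2) := fun h => hus (Prod.ext h.1 h.2)
          unfold KAdj at *; omega
      · intro h; exact absurd (mem_product.2 ⟨hsJ, hrJ⟩) h
    simp only [h0, h1]; decide

end Crossing

/-! ### Upper bound: the two sides of the curve. -/

/-- Two points off `J` are joined if a path of adjacent points off `J` leads from one to the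
other. -/
def Joined (J : Finset (ℤ × ℤ)) : ℤ × ℤ → ℤ × ℤ → Prop :=
  ReflTransGen fun x y => x ∉ J ∧ y ∉ J ∧ KAdj x y

theorem Joined.symm {J : Finset (ℤ × ℤ)} {x y : ℤ × ℤ} (h : Joined J x y) : Joined J y x :=
  have : Std.Symm fun x y => x ∉ J ∧ y ∉ J ∧ KAdj x y :=
    ⟨fun _ _ h => ⟨h.2.1, h.1, h.2.2.symm⟩⟩
  _root_.symm (r := ReflTransGen _) h

theorem exists_link_of_offsets (v : ℤ × ℤ) {n : ℕ} (hn : n = 4 ∨ n = 8) (o : Fin n → ℤ × ℤ)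
    (hinj : ∀ i j, (o i).1 = (o j).1 ∧ (o i).2 = (o j).2 → i = j)
    (hadj : ∀ i j : Fin n, (j : ℕ) = (i + 1) % n → KAdj (v + o i) (v + o j))
    (hmem : ∀ y, KAdj v y ↔ ∃ k, y = v + o k) :
    ∃ (L : ℤ) (c : ℤ → ℤ × ℤ), 0 < L ∧ Function.Periodic c L ∧
      (∀ k l, k < l → l < k + L → c k ≠ c l) ∧ (∀ k, KAdj (c k) (c (k + 1))) ∧
      ∀ y, KAdj v y ↔ ∃ k, y = c k := by
  have hlt : ∀ k : ℤ, (k % n).toNat < n := fun k => by rcases hn with rfl | rfl <;> omega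
  refine ⟨n, fun k => v + o ⟨(k % n).toNat, hlt k⟩, by omega, ?_, ?_, ?_, ?_⟩
  · intro k
    simp only [Int.add_emod_right]
  · intro k l h1 h2 h
    have h3 := congrArg Fin.val (hinj _ _ (Prod.ext_iff.1 (add_left_cancel h)))
    dsimp only at h3
    rcases hn with rfl | rfl <;> omega
  · intro k
    refine hadj _ _ ?_
    dsimp only
    rcases hn with rfl | rfl <;> omega
  · intro y
    rw [hmem]
    constructor
    · rintro ⟨k, rfl⟩
      refine ⟨k, ?_⟩
      congr 2
      ext
      dsimp only
      have := k.2
      rcases hn with rfl | rfl <;> omega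
    · rintro ⟨k, rfl⟩
      exact ⟨_, rfl⟩

/-- The neighbours of `v` in cyclic order. -/
theorem exists_link (v : ℤ × ℤ) : ∃ (L : ℤ) (c : ℤ → ℤ × ℤ), 0 < L ∧ Function.Periodic c L ∧
    (∀ k l, k < l → l < k + L → c k ≠ c l) ∧ (∀ k, KAdj (c k) (c (k + 1))) ∧
    ∀ y, KAdj v y ↔ ∃ k, y = c k := by
  by_cases hv : (v.1 - v.2) % 2 = 0
  · obtain ⟨o, hinj, hadj, hmem, hsurj⟩ : ∃ o : Fin 8 → ℤ × ℤ,
        (∀ i j, (o i).1 = (o j).1 ∧ (o i).2 = (o j).2 → i = j) ∧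
        (∀ i j : Fin 8, (j : ℕ) = (i + 1) % 8 → KAdj (o i) (o j) ∧
          ((o i).1 = (o j).1 ∨ (o i).2 = (o j).2)) ∧
        (∀ k, KAdj (0, 0) (o k)) ∧ ∀ i j : Fin 3, ¬(i.val = 1 ∧ j.val = 1) →
          ∃ k, (o k).1 = (i.val : ℤ) - 1 ∧ (o k).2 = (j.val : ℤ) - 1 :=
      ⟨![(1, 0), (1, 1), (0, 1), (-1, 1), (-1, 0), (-1, -1), (0, -1), (1, -1)],
        by decide, by decide, by decide, by decide⟩
    refine exists_link_of_offsets v (Or.inr rfl) o hinj (fun i j h => ?_) fun y => ⟨fun h => ?_, ?_⟩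
    · have := hadj i j h
      unfold KAdj at *
      simp only [Prod.fst_add, Prod.snd_add]
      omega
    · unfold KAdj at h
      obtain ⟨k, hk⟩ := hsurj ⟨(y.1 - v.1 + 1).toNat, by omega⟩ ⟨(y.2 - v.2 + 1).toNat, by omega⟩
        (by dsimp only; omega)
      refine ⟨k, Prod.ext ?_ ?_⟩ <;> simp only [Prod.fst_add, Prod.snd_add] <;>
        dsimp only at hk <;> omega
    · rintro ⟨k, rfl⟩
      have := hmem k
      unfold KAdj at *
      simp only [Prod.fst_add, Prod.snd_add] at *
      omega
  · obtain ⟨o, hinj, hadj, hmem, hsurj⟩ : ∃ o : Fin 4 → ℤ × ℤ,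
        (∀ i j, (o i).1 = (o j).1 ∧ (o i).2 = (o j).2 → i = j) ∧
        -- The shift by `(1, 0)` accounts for `v` being mixed: its neighbours are pure, hence
        -- diagonally adjacent.
        (∀ i j : Fin 4, (j : ℕ) = (i + 1) % 4 → KAdj ((o i).1 + 1, (o i).2) ((o j).1 + 1, (o j).2) ∧
          ((o i).1 - (o i).2) % 2 = 1) ∧
        (∀ k, KAdj (0, 0) (o k) ∧ ((o k).1 = 0 ∨ (o k).2 = 0)) ∧
        ∀ i j : Fin 3, ¬(i.val = 1 ∧ j.val = 1) → i.val = 1 ∨ j.val = 1 →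
          ∃ k, (o k).1 = (i.val : ℤ) - 1 ∧ (o k).2 = (j.val : ℤ) - 1 :=
      ⟨![(1, 0), (0, 1), (-1, 0), (0, -1)], by decide, by decide, by decide, by decide⟩
    refine exists_link_of_offsets v (Or.inl rfl) o hinj (fun i j h => ?_) fun y => ⟨fun h => ?_, ?_⟩
    · have := hadj i j h
      unfold KAdj at *
      simp only [Prod.fst_add, Prod.snd_add] at *
      omega
    · unfold KAdj at h
      obtain ⟨k, hk⟩ := hsurj ⟨(y.1 - v.1 + 1).toNat, by omega⟩ ⟨(y.2 - v.2 + 1).toNat, by omega⟩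
        (by dsimp only; omega) (by dsimp only; omega)
      refine ⟨k, Prod.ext ?_ ?_⟩ <;> simp only [Prod.fst_add, Prod.snd_add] <;>
        dsimp only at hk <;> omega
    · rintro ⟨k, rfl⟩
      have := hmem k
      unfold KAdj at *
      simp only [Prod.fst_add, Prod.snd_add] at *
      omega

section Sides

variable {J : Finset (ℤ × ℤ)} (hdeg : ∀ u ∈ J, #{v ∈ J | KAdj u v} = 2)
  (htri : ∀ u ∈ J, ∀ v ∈ J, ∀ w ∈ J, KAdj u v → KAdj v w → ¬KAdj u w)

include hdeg htri in
-- `z` and `z'` are the points next to `w` on the cycle around `v`; they are off `J` because `J` has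
-- no triangle. Adjacency to `w` too is what carries the sides along `J`.
theorem exists_sides {v w : ℤ × ℤ} (hv : v ∈ J) (hw : w ∈ J) (hvw : KAdj v w) :
    ∃ z z', KAdj v z ∧ KAdj w z ∧ z ∉ J ∧ KAdj v z' ∧ KAdj w z' ∧ z' ∉ J ∧
      ∀ y, y ∉ J → KAdj v y → Joined J y z ∨ Joined J y z' := by
  obtain ⟨L, c, hL, hper, hinj, hadj, hmem⟩ := exists_link v
  obtain ⟨i, rfl⟩ := (hmem w).1 hvw
  have hlink : ∀ k, KAdj v (c k) := fun k => (hmem _).2 ⟨k, rfl⟩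
  have hwz : KAdj (c i) (c (i + 1)) := hadj i
  have hwz' : KAdj (c i) (c (i - 1)) := by
    have := hadj (i - 1)
    rw [sub_add_cancel] at this
    exact this.symm
  have hrep : ∀ y, KAdj v y → y ≠ c i → ∃ k, i < k ∧ k < i + L ∧ y = c k := by
    intro y hy hne
    obtain ⟨k, rfl⟩ := (hmem y).1 hy
    have hk : c (i + (k - i) % L) = c k := by
      have := hper.int_mul ((k - i) / L) (i + (k - i) % L)
      rw [← this]
      congr 1
      have := Int.emod_add_mul_ediv (k - i) L
      push_cast
      linarith
    have h0 : (k - i) % L ≠ 0 := fun h => hne (by rw [← hk, h, add_zero])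
    have h1 := Int.emod_nonneg (k - i) hL.ne'
    have h2 := Int.emod_lt_of_pos (k - i) hL
    exact ⟨i + (k - i) % L, by omega, by omega, hk.symm⟩
  obtain ⟨j, hij, hjL, hjJ, hj⟩ : ∃ j, i < j ∧ j < i + L ∧ c j ∈ J ∧
      ∀ k, i < k → k < i + L → c k ∈ J → k = j := by
    obtain ⟨p, q, hpq, hN⟩ := card_eq_two.1 (hdeg v hv)
    have hN' : ∀ u, u ∈ J ∧ KAdj v u ↔ u = p ∨ u = q := fun u => by
      rw [← mem_filter, hN, mem_insert, mem_singleton]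
    obtain ⟨r, hr, hne⟩ : ∃ r, (∀ u, u ∈ J ∧ KAdj v u ↔ u = c i ∨ u = r) ∧ r ≠ c i := by
      rcases (hN' _).1 ⟨hw, hvw⟩ with h | h
      · exact ⟨q, h ▸ hN', h ▸ hpq.symm⟩
      · exact ⟨p, fun u => by rw [hN', h, or_comm], h ▸ hpq⟩
    obtain ⟨j, hij, hjL, rfl⟩ := hrep r ((hr r).2 (Or.inr rfl)).2 hne
    refine ⟨j, hij, hjL, ((hr _).2 (Or.inr rfl)).1, fun k hk hkL hkJ => ?_⟩
    rcases (hr _).1 ⟨hkJ, hlink k⟩ with h | h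
    · exact absurd h.symm (hinj i k hk hkL)
    · rcases lt_trichotomy k j with h' | h' | h'
      · exact absurd h (hinj k j h' (by omega))
      · exact h'
      · exact absurd h.symm (hinj j k h' (by omega))
  refine ⟨c (i + 1), c (i - 1), hlink _, hwz, fun h => htri v hv _ hw _ h hvw hwz (hlink _),
    hlink _, hwz', fun h => htri v hv _ hw _ h hvw hwz' (hlink _), fun y hy hvy => ?_⟩
  obtain ⟨k, hik, hkL, rfl⟩ := hrep y hvy (by rintro rfl; exact hy hw)
  have hoff : ∀ t, i < t → t < i + L → t ≠ j → c t ∉ J := fun t h1 h2 h3 h4 => h3 (hj t h1 h2 h4)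
  rcases lt_or_gt_of_ne (fun h : k = j => hy (h ▸ hjJ)) with hkj | hkj
  · left
    suffices h : ∀ t, i + 1 ≤ t → t < j → Joined J (c t) (c (i + 1)) from h k hik hkj
    intro t ht
    induction t, ht using Int.leInduction with
    | base => exact fun _ => .refl
    | succ t ht ih =>
      exact fun h => .head ⟨hoff _ (by omega) (by omega) (by omega),
        hoff _ (by omega) (by omega) (by omega), (hadj t).symm⟩ (ih (by omega))
  · right
    have hp : c (i - 1) = c (i + L - 1) := by
      rw [← hper (i - 1)]; congr 1; ring
    rw [hp]
    suffices h : ∀ t, t ≤ i + L - 1 → j < t → Joined J (c t) (c (i + L - 1)) from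
      h k (by omega) hkj
    intro t ht
    induction t, ht using Int.leInductionDown with
    | base => exact fun _ => .refl
    | pred t ht ih =>
      intro h
      have h1 := hadj (t - 1)
      rw [sub_add_cancel] at h1
      exact .head ⟨hoff _ (by omega) (by omega) (by omega),
        hoff _ (by omega) (by omega) (by omega), h1⟩ (ih (by omega))

include hdeg htri in
/-- The complement of `J` has at most two classes of joined points. -/
theorem exists_joined_or_joined (hne : J.Nonempty)
    (hconn : ∀ P : ℤ × ℤ → Prop, (∃ u ∈ J, P u) →
      (∀ u ∈ J, ∀ v ∈ J, KAdj u v → P u → P v) → ∀ u ∈ J, P u) :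
    ∃ z z', z ∉ J ∧ z' ∉ J ∧ ∀ x, x ∉ J → Joined J x z ∨ Joined J x z' := by
  obtain ⟨v, hv⟩ := hne
  obtain ⟨w, hw⟩ : {u ∈ J | KAdj v u}.Nonempty := card_pos.1 (by rw [hdeg v hv]; norm_num)
  obtain ⟨hw, hvw⟩ := mem_filter.1 hw
  obtain ⟨z, z', -, -, hz, -, -, hz', hzz⟩ := exists_sides hdeg htri hv hw hvw
  have key := hconn (fun u => ∀ y, y ∉ J → KAdj u y → Joined J y z ∨ Joined J y z') ⟨v, hv, hzz⟩ <| by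
    intro u hu t ht hut ih y hy hty
    obtain ⟨p, p', -, hup, hp, -, hup', hp', hpp⟩ := exists_sides hdeg htri ht hu hut.symm
    rcases hpp y hy hty with h | h
    · exact (ih p hp hup).imp h.trans h.trans
    · exact (ih p' hp' hup').imp h.trans h.trans
  refine ⟨z, z', hz, hz', fun x hx => ?_⟩
  -- Follow a path from `x` to the curve; just before first meeting `J` it is at a neighbour of `J`,
  -- where `key` applies.
  have hpath := reflTransGen_kAdj x v
  induction hpath using ReflTransGen.head_induction_on with
  | refl => exact absurd hv hx
  | @head a b hab _ ih =>
    by_cases hb : b ∈ J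
    · exact key b hb a hx hab.symm
    · have : Joined J a b := .single ⟨hx, hb, hab⟩
      exact (ih hb).imp this.trans this.trans

end Sides

end DigitalTopology

/-! ### From the topology to the graph. -/

namespace DigitalTopology

open Finset Topology

theorem DigitalLine.mem_basicNhd_toInt {x y : DigitalLine} :
    x ∈ DigitalLine.basicNhd y.toInt ↔
      x.toInt = y.toInt ∨ y.toInt % 2 = 0 ∧ (x.toInt = y.toInt - 1 ∨ x.toInt = y.toInt + 1) := by
  unfold DigitalLine.basicNhd
  rw [Set.mem_ofPred_eq]
  split_ifs with h
  · rw [Int.odd_iff] at h; omega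
  · rw [Int.not_odd_iff] at h; omega

theorem DigitalLine.isOpen_basicNhd (n : ℤ) : IsOpen (DigitalLine.basicNhd n) :=
  TopologicalSpace.isOpen_generateFrom_of_mem ⟨n, rfl⟩

theorem DigitalLine.specializes_iff {x y : DigitalLine} :
    x ⤳ y ↔
      x.toInt = y.toInt ∨ y.toInt % 2 = 0 ∧ (x.toInt = y.toInt - 1 ∨ x.toInt = y.toInt + 1) := by
  rw [← DigitalLine.mem_basicNhd_toInt]
  constructor
  · intro h
    exact h.mem_open (DigitalLine.isOpen_basicNhd _)
      (DigitalLine.mem_basicNhd_toInt.2 (Or.inl rfl))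
  · intro h
    unfold Specializes
    conv_rhs => rw [TopologicalSpace.nhds_generateFrom]
    refine le_iInf₂ fun s hs => Filter.le_principal_iff.2 ?_
    obtain ⟨hys, n, rfl⟩ := hs
    refine (DigitalLine.isOpen_basicNhd n).mem_nhds ?_
    rw [DigitalLine.mem_basicNhd_toInt] at h
    unfold DigitalLine.basicNhd at *
    rw [Set.mem_ofPred_eq] at *
    split_ifs at * with hn
    · rw [Int.odd_iff] at hn; omega
    · rw [Int.not_odd_iff] at hn; omega

instance : AlexandrovDiscrete DigitalLine := by
  refine alexandrovDiscrete_iff_nhds.2 fun a => le_antisymm (Filter.le_principal_iff.2 ?_) ?_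
  · refine Filter.mem_of_superset ((DigitalLine.isOpen_basicNhd a.toInt).mem_nhds
      (DigitalLine.mem_basicNhd_toInt.2 (Or.inl rfl))) fun x hx => ?_
    rw [mem_nhdsKer_singleton, DigitalLine.specializes_iff]
    exact DigitalLine.mem_basicNhd_toInt.1 hx
  · intro s hs
    refine Filter.mem_principal.2 fun x hx => ?_
    exact mem_of_mem_nhds ((mem_nhdsKer_singleton.1 hx) hs)

/-- The pair of integer coordinates of a point of the digital plane. -/
def coords : DigitalPlane ≃ ℤ × ℤ where
  toFun x := (x.1.toInt, x.2.toInt)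
  invFun p := (DigitalLine.ofInt p.1, DigitalLine.ofInt p.2)
  left_inv _ := rfl
  right_inv _ := rfl

theorem coords_fst (x : DigitalPlane) : (coords x).1 = x.1.toInt := rfl

theorem coords_snd (x : DigitalPlane) : (coords x).2 = x.2.toInt := rfl

theorem kAdj_coords_iff {x y : DigitalPlane} :
    KAdj (coords x) (coords y) ↔ x ≠ y ∧ (x ⤳ y ∨ y ⤳ x) := by
  have hx : x = (x.1, x.2) := rfl
  have hy : y = (y.1, y.2) := rfl
  rw [← coords.injective.ne_iff, hx, hy, specializes_prod, specializes_prod, Ne, Prod.ext_iff]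
  simp only [DigitalLine.specializes_iff, KAdj, coords_fst, coords_snd]
  omega

/-- A homeomorphism preserves specialization, hence adjacency. The value `0` outside the interval is
arbitrary. -/
theorem IsArc.exists_param {C : Set DigitalPlane} (hC : IsArc C) :
    ∃ (a b : ℤ) (f : ℤ → ℤ × ℤ), a ≤ b ∧ Set.BijOn f (Set.Icc a b) (coords '' C) ∧
      ∀ i ∈ Set.Icc a b, ∀ j ∈ Set.Icc a b, KAdj (f i) (f j) ↔ j = i + 1 ∨ i = j + 1 := by
  classical
  obtain ⟨a, b, hab, ⟨h⟩⟩ := hC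
  have hf : ∀ i (hi : i ∈ Set.Icc a b), (fun i => if hi : i ∈ Set.Icc a b then
      coords (h ⟨DigitalLine.ofInt i, hi⟩) else 0) i = coords (h ⟨DigitalLine.ofInt i, hi⟩) :=
    fun i hi => dif_pos hi
  refine ⟨a, b, fun i => if hi : i ∈ Set.Icc a b then coords (h ⟨DigitalLine.ofInt i, hi⟩) else 0,
    hab, ⟨fun i hi => ?_, fun i hi j hj hij => ?_, ?_⟩, fun i hi j hj => ?_⟩
  · rw [hf i hi]
    exact ⟨_, (h _).2, rfl⟩
  · rw [hf i hi, hf j hj] at hij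
    exact congrArg Subtype.val (h.injective (Subtype.ext (coords.injective hij)))
  · rintro _ ⟨x, hx, rfl⟩
    refine ⟨(h.symm ⟨x, hx⟩).1.toInt, (h.symm ⟨x, hx⟩).2, (hf _ (h.symm ⟨x, hx⟩).2).trans ?_⟩
    exact congrArg (fun y : C => coords y.1) (h.apply_symm_apply ⟨x, hx⟩)
  · rw [hf i hi, hf j hj, kAdj_coords_iff, Subtype.coe_injective.ne_iff, h.injective.ne_iff,
      ← subtype_specializes_iff, ← subtype_specializes_iff, h.isInducing.specializes_iff,
      h.isInducing.specializes_iff, subtype_specializes_iff, subtype_specializes_iff,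
      DigitalLine.specializes_iff, DigitalLine.specializes_iff, ← Subtype.coe_injective.ne_iff]
    change ¬(i = j) ∧ ((i = j ∨ j % 2 = 0 ∧ (i = j - 1 ∨ i = j + 1)) ∨
      (j = i ∨ i % 2 = 0 ∧ (j = i - 1 ∨ j = i + 1))) ↔ _
    omega

theorem sum_sum_boole_Icc {a b : ℤ} (hab : a ≤ b) :
    ∑ i ∈ Icc a b, ∑ j ∈ Icc a b, (if j = i + 1 ∨ i = j + 1 then 1 else 0 : ℤ) = 2 * (b - a) := by
  have h1 : ∑ i ∈ Icc a b, ∑ j ∈ Icc a b, (if j = i + 1 then 1 else 0 : ℤ) = b - a := by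
    simp only [sum_ite_eq']
    rw [sum_boole]
    have : {i ∈ Icc a b | i + 1 ∈ Icc a b} = Icc a (b - 1) := by
      ext i; simp only [mem_filter, mem_Icc]; omega
    rw [this, Int.card_Icc]
    omega
  have h2 : ∑ i ∈ Icc a b, ∑ j ∈ Icc a b, (if i = j + 1 then 1 else 0 : ℤ) = b - a := by
    rw [sum_comm, h1]
  rw [two_mul]
  nth_rewrite 1 [← h1]
  rw [← h2, ← sum_add_distrib]
  refine sum_congr rfl fun i _ => ?_
  rw [← sum_add_distrib]
  refine sum_congr rfl fun j _ => ?_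
  split_ifs <;> omega

/-! ### A Jordan curve is a cycle without triangles. -/

section Cycle

variable {J : Finset (ℤ × ℤ)} (hcard : 4 ≤ #J)
  (harc : ∀ x ∈ J, ∃ (a b : ℤ) (f : ℤ → ℤ × ℤ), a ≤ b ∧
    Set.BijOn f (Set.Icc a b) (J.erase x : Finset (ℤ × ℤ)) ∧
    ∀ i ∈ Set.Icc a b, ∀ j ∈ Set.Icc a b, KAdj (f i) (f j) ↔ j = i + 1 ∨ i = j + 1)

include hcard harc in
theorem triangle_free_of_erase_arc :
    ∀ u ∈ J, ∀ v ∈ J, ∀ w ∈ J, KAdj u v → KAdj v w → ¬KAdj u w := by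
  intro u hu v hv w hw huv hvw huw
  -- Deleting a fourth point would leave the triangle inside a path.
  obtain ⟨x, hx, hxn⟩ : ∃ x ∈ J, x ∉ ({u, v, w} : Finset (ℤ × ℤ)) := by
    by_contra! h
    have := (card_le_card (show J ⊆ {u, v, w} from h)).trans card_le_three
    omega
  simp only [mem_insert, mem_singleton, not_or] at hxn
  obtain ⟨a, b, f, -, hf, hadj⟩ := harc x hx
  obtain ⟨i, hi, rfl⟩ := hf.surjOn (mem_coe.2 (mem_erase.2 ⟨Ne.symm hxn.1, hu⟩))
  obtain ⟨j, hj, rfl⟩ := hf.surjOn (mem_coe.2 (mem_erase.2 ⟨Ne.symm hxn.2.1, hv⟩))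
  obtain ⟨k, hk, rfl⟩ := hf.surjOn (mem_coe.2 (mem_erase.2 ⟨Ne.symm hxn.2.2, hw⟩))
  rw [hadj i hi j hj] at huv
  rw [hadj j hj k hk] at hvw
  rw [hadj i hi k hk] at huw
  omega

include hcard harc in
-- With `n = #J`, deleting `x` leaves a path with `n - 2` edges, so the degree sum is `2 * d x + 2 *
-- (n - 2)`. Thus `d` is constant and `(n - 2) * (d - 2) = 0`.
theorem card_neighbours_of_erase_arc : ∀ u ∈ J, #{v ∈ J | KAdj u v} = 2 := by
  set d : ℤ × ℤ → ℤ := fun u => #{v ∈ J | KAdj u v} with hd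
  have hdsum : ∀ u, d u = ∑ v ∈ J, if KAdj u v then 1 else 0 := fun u => by
    rw [sum_boole]
  have key : ∀ x ∈ J, ∑ u ∈ J, d u = 2 * d x + 2 * (#J - 2) := by
    intro x hx
    obtain ⟨a, b, f, hab, hf, hadj⟩ := harc x hx
    have himg : (Icc a b).image f = J.erase x := by
      rw [← coe_inj, coe_image, coe_Icc]; exact hf.image_eq
    have hinj : Set.InjOn f (Icc a b : Finset ℤ) := by rw [coe_Icc]; exact hf.injOn
    have hn : (#J : ℤ) = b - a + 2 := by
      have h1 := card_image_of_injOn hinj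
      rw [himg, card_erase_of_mem hx, Int.card_Icc] at h1
      omega
    have hE : ∑ u ∈ J.erase x, ∑ v ∈ J.erase x, (if KAdj u v then 1 else 0 : ℤ) =
        2 * (b - a) := by
      rw [← himg, sum_image hinj, ← sum_sum_boole_Icc hab]
      refine sum_congr rfl fun i hi => ?_
      rw [sum_image hinj]
      refine sum_congr rfl fun j hj => if_congr (hadj i ?_ j ?_) rfl rfl
      · exact mem_Icc.1 hi
      · exact mem_Icc.1 hj
    have h1 : ∀ u, d u = (if KAdj u x then 1 else 0) +
        ∑ v ∈ J.erase x, if KAdj u v then 1 else 0 := fun u => by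
      exact (hdsum u).trans (add_sum_erase J (fun v => if KAdj u v then (1 : ℤ) else 0) hx).symm
    have h2 : ∑ u ∈ J.erase x, (if KAdj u x then 1 else 0 : ℤ) = d x := by
      rw [h1 x, if_neg fun h => h.ne rfl, zero_add]
      exact sum_congr rfl fun u _ => if_congr ⟨KAdj.symm, KAdj.symm⟩ rfl rfl
    rw [← add_sum_erase _ _ hx, sum_congr rfl fun u _ => h1 u, sum_add_distrib, h2, hE]
    linarith
  intro u hu
  have hconst : ∀ x ∈ J, d x = d u := fun x hx => by
    have := key x hx; have := key u hu; linarith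
  have h1 := key u hu
  rw [sum_congr rfl hconst, sum_const, nsmul_eq_mul] at h1
  have h2 : ((#J : ℤ) - 2) * (d u - 2) = 0 := by linarith
  have h3 : (4 : ℤ) ≤ #J := by exact_mod_cast hcard
  rcases mul_eq_zero.1 h2 with h | h
  · omega
  · have : (#{v ∈ J | KAdj u v} : ℤ) = 2 := sub_eq_zero.1 h
    exact_mod_cast this

end Cycle

/-! ### Counting the components. -/

/-- The Jordan curve theorem for the digital plane. -/
theorem IsJordanCurve.card_connectedComponents_compl {J : Set DigitalPlane}
    (hJ : IsJordanCurve J) : Nat.card (ConnectedComponents ↥(Jᶜ)) = 2 := by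
  classical
  obtain ⟨hconn, hcard, harc⟩ := hJ
  obtain ⟨x₀, hx₀⟩ := hconn.nonempty
  have hfin : (coords '' J).Finite := by
    obtain ⟨a, b, f, -, hf, -⟩ := (harc x₀ hx₀).exists_param
    have h1 : (coords '' (J \ {x₀})).Finite := hf.image_eq ▸ (Set.finite_Icc a b).image f
    rw [Set.finite_image_iff coords.injective.injOn] at h1 ⊢
    exact (h1.insert x₀).subset fun y hy => by
      by_cases h : y = x₀
      · exact Or.inl h
      · exact Or.inr ⟨hy, h⟩
  obtain ⟨F, hF⟩ := hfin.exists_finset_coe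
  have hmem : ∀ x, coords x ∈ F ↔ x ∈ J := fun x => by
    rw [← mem_coe, hF, coords.injective.mem_set_image]
  have hFcard : 4 ≤ #F := by
    rw [← coords.injective.encard_image, ← hF, Set.encard_coe_eq_coe_finsetCard] at hcard
    exact_mod_cast hcard
  have hFarc : ∀ x ∈ F, ∃ (a b : ℤ) (f : ℤ → ℤ × ℤ), a ≤ b ∧
      Set.BijOn f (Set.Icc a b) (F.erase x : Finset (ℤ × ℤ)) ∧
      ∀ i ∈ Set.Icc a b, ∀ j ∈ Set.Icc a b, KAdj (f i) (f j) ↔ j = i + 1 ∨ i = j + 1 := by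
    intro x hx
    obtain ⟨y, rfl⟩ := coords.surjective x
    have := (harc y ((hmem y).1 hx)).exists_param
    rwa [Set.image_sdiff coords.injective, Set.image_singleton, ← hF, ← coe_erase] at this
  have hdeg := card_neighbours_of_erase_arc hFcard hFarc
  have htri := triangle_free_of_erase_arc hFcard hFarc
  have hne : F.Nonempty := ⟨_, (hmem x₀).2 hx₀⟩
  have hFconn : ∀ P : ℤ × ℤ → Prop, (∃ u ∈ F, P u) →
      (∀ u ∈ F, ∀ v ∈ F, KAdj u v → P u → P v) → ∀ u ∈ F, P u := by
    intro P ⟨u, hu, hPu⟩ hP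
    have : PreconnectedSpace J := isPreconnected_iff_preconnectedSpace.1 hconn.isPreconnected
    have hstep : ∀ x y : J, x ⤳ y ∨ y ⤳ x → P (coords x) → P (coords y) := by
      intro x y h hx
      by_cases hxy : (x : DigitalPlane) = y
      · rwa [← hxy]
      · rw [subtype_specializes_iff, subtype_specializes_iff] at h
        exact hP _ ((hmem _).2 x.2) _ ((hmem _).2 y.2) (kAdj_coords_iff.2 ⟨hxy, h⟩) hx
    have hclopen : IsClopen {x : J | P (coords x)} := by
      refine ⟨⟨isOpen_iff_forall_specializes.2 fun x y h hy hx => ?_⟩,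
        isOpen_iff_forall_specializes.2 fun x y h hy => hstep y x (Or.inr h) hy⟩
      exact hy (hstep x y (Or.inl h) hx)
    obtain ⟨x, rfl⟩ := coords.surjective u
    have huniv := hclopen.eq_univ ⟨⟨x, (hmem x).1 hu⟩, hPu⟩
    intro v hv
    obtain ⟨y, rfl⟩ := coords.surjective v
    exact huniv.ge (Set.mem_univ (⟨y, (hmem y).1 hv⟩ : J))
  have hstep : ∀ x y : ↥(Jᶜ), KAdj (coords x) (coords y) →
      (x : ConnectedComponents ↥(Jᶜ)) = y := by
    intro x y h
    rcases (kAdj_coords_iff.1 h).2 with h | h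
    · exact (((subtype_specializes_iff x y).2 h).map ConnectedComponents.continuous_coe).eq
    · exact (((subtype_specializes_iff y x).2 h).map ConnectedComponents.continuous_coe).eq.symm
  have hjoin : ∀ x y : ↥(Jᶜ), Joined F (coords x) (coords y) →
      (x : ConnectedComponents ↥(Jᶜ)) = y := by
    intro x y h
    generalize hv : coords (y : DigitalPlane) = v at h
    induction h generalizing y with
    | refl => exact congrArg _ (Subtype.ext (coords.injective hv.symm))
    | @tail b c _ hbc ih =>
      obtain ⟨w, rfl⟩ := coords.surjective b
      have hw : w ∈ Jᶜ := fun h => hbc.1 ((hmem w).2 h)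
      subst hv
      exact (ih ⟨w, hw⟩ rfl).trans (hstep ⟨w, hw⟩ y hbc.2.2)
  have hcross : ∀ x y : ↥(Jᶜ), (x : ConnectedComponents ↥(Jᶜ)) = y →
      crossing F (coords x).1 (coords x).2 = crossing F (coords y).1 (coords y).2 := by
    intro x y h
    have hinv : ∀ u v : ↥(Jᶜ), u ⤳ v →
        crossing F (coords u).1 (coords u).2 = crossing F (coords v).1 (coords v).2 := by
      intro u v huv
      by_cases h : (u : DigitalPlane) = v
      · rw [h]
      · exact crossing_eq_of_kAdj hdeg (fun h => u.2 ((hmem _).1 h)) (fun h => v.2 ((hmem _).1 h))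
          (kAdj_coords_iff.2 ⟨h, Or.inl ((subtype_specializes_iff u v).1 huv)⟩)
    have hclopen : IsClopen {u : ↥(Jᶜ) | crossing F (coords u).1 (coords u).2 =
        crossing F (coords y).1 (coords y).2} :=
      ⟨⟨isOpen_iff_forall_specializes.2 fun u v huv hv hu => hv ((hinv u v huv).symm.trans hu)⟩,
        isOpen_iff_forall_specializes.2 fun u v huv hv => (hinv u v huv).trans hv⟩
    exact hclopen.connectedComponent_subset rfl (ConnectedComponents.coe_eq_coe'.1 h)
  obtain ⟨u, v, hu, hv, huv⟩ := exists_crossing_ne hdeg hne htri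
  obtain ⟨z, z', hz, hz', hall⟩ := exists_joined_or_joined hdeg htri hne hFconn
  obtain ⟨u, rfl⟩ := coords.surjective u
  obtain ⟨v, rfl⟩ := coords.surjective v
  obtain ⟨z, rfl⟩ := coords.surjective z
  obtain ⟨z', rfl⟩ := coords.surjective z'
  rw [hmem] at hu hv hz hz'
  have htwo : ∀ x : ↥(Jᶜ), (x : ConnectedComponents ↥(Jᶜ)) = (⟨z, hz⟩ : ↥(Jᶜ)) ∨
      (x : ConnectedComponents ↥(Jᶜ)) = (⟨z', hz'⟩ : ↥(Jᶜ)) := fun x =>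
    (hall (coords x) fun h => x.2 ((hmem _).1 h)).imp (hjoin x ⟨z, hz⟩) (hjoin x ⟨z', hz'⟩)
  refine Nat.card_eq_two_iff.2 ⟨((⟨z, hz⟩ : ↥(Jᶜ)) : ConnectedComponents ↥(Jᶜ)),
    ((⟨z', hz'⟩ : ↥(Jᶜ)) : ConnectedComponents ↥(Jᶜ)), fun h => ?_,
    Set.eq_univ_of_forall fun c => ?_⟩
  -- If the two components coincided, `u` and `v` would share one despite their different parities.
  · refine huv (hcross ⟨u, hu⟩ ⟨v, hv⟩ ?_)
    rcases htwo ⟨u, hu⟩ with h1 | h1 <;> rcases htwo ⟨v, hv⟩ with h2 | h2 <;> simp only [h1, h2, h]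
  · obtain ⟨x, rfl⟩ := ConnectedComponents.surjective_coe c
    exact htwo x

end DigitalTopology

theorem mainTheorem7 (J : Set DigitalTopology.DigitalPlane) (m : DigitalTopology.DigitalPlane)
    (hJ : DigitalTopology.IsJordanCurve J)
    (hS : DigitalTopology.threeAdjacent J = {m})
    (hstar : DigitalTopology.slantStar (DigitalTopology.slant ⁻¹' J) = J ∪ {m}) :
    Nat.card (ConnectedComponents ↥(Jᶜ)) = 2 :=
  hJ.card_connectedComponents_compl
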